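/- Let $X$ be a metric space with its Borel $\sigma$-algebra, and let $\pi : X\times\mathcal B(X)\to[0,1]$ be the transition function of a discrete-time Markov chain $\Phi$ on $X$, that is, $\pi(x,\cdot)$ is a Borel probability measure for every $x\in X$ and $\pi(\cdot,A)$ is Borel measurable for every $A\in\mathcal B(X)$. Let $\pi^n$ denote its $n$-step transition function, $\pi^0(x,\cdot)=\delta_x$ and $\pi^{n+1}(x,A)=\int_X \pi^n(y,A)\,\pi(x,dy)$. Assume that $\pi$ is Feller: for every $\varphi\in C_b(X)$ (the bounded continuous real functions on $X$) the function $x\mapsto\int_X\varphi(y)\,\pi(x,dy)$ is continuous. Assume that there exist a point $z\in X$ and a Borel probability measure $\mu$ on $X$ such that for every $\varepsilon>0$ $$\liminf_{n\to\infty}\ \frac1n\sum_{i=1}^n\int_X \pi^i\big(x,B(z,\varepsilon)\big)\,\mu(dx)>0,$$ where $B(z,\varepsilon)$ is the open ball. If for every $\varphi\in C_b(X)$ the family of functions $x\mapsto\int_X\varphi(y)\,\pi^n(x,dy)$, $n\in\mathbb N$, is equicontinuous at the point $z$, then $\Phi$ has an invariant probability measure, that is, there is a Borel probability measure $\nu$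 on $X$ with $\int_X\pi(x,A)\,\nu(dx)=\nu(A)$ for all $A\in\mathcal B(X)$. -/

import Mathlib

open MeasureTheory ProbabilityTheory Filter Topology
open scoped ENNReal BoundedContinuousFunction

/-- The Feller property of a transition function: the associated operator
`φ ↦ (x ↦ ∫ φ(y) π(x, dy))` maps bounded continuous functions to (bounded) continuous functions. -/
def IsFellerKernel {X : Type*} [TopologicalSpace X] [MeasurableSpace X] (π : Kernel X X) : Prop :=
  ∀ φ : X →ᵇ ℝ, Continuous fun x : X => ∫ y, φ y ∂(π x)

/-! The measure `ν` represents a limit `Λ`, along an ultrafilter, of the Cesàro averages of the laws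
`π ^ i` started at `z`. Telescoping and the Feller property make `Λ` invariant. As `X` need not be
complete or separable, tightness is replaced by `SigmaSmooth`, which is what the Daniell
representation `exists_isProbabilityMeasure_integral_eq` needs.

Smoothness follows from `φ k ↓ 0` implying `∫ φ k d(π ^ n) z → 0` uniformly in `n`
(`exists_forall_integral_le`). If this fails, differences of a sparse subsequence give nonnegative
`f i` with bounded continuous sum, each carrying a fixed mass at some time `N i` from `z`. All
subseries are continuous, so Baire category on `ℕ → Bool` turns equicontinuity of each subseries
into one radius `δ` valid for all late `f i` (`exists_uniform_equicontinuity`). The chain started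
from `μ` visits that ball with positive frequency, so each late `f i` has average mass at least a
fixed constant. Enough of them exceed the bound on their sum (`false_of_forall_le_integral`). -/

namespace DaniellMetric

/-! ### Daniell representation on a metric space -/

variable {X : Type*} [MetricSpace X]

/-- The infimum of a functional over the nonnegative bounded continuous functions that dominate the
indicator of a set. -/
noncomputable def preOuter (Λ : (X →ᵇ ℝ) →ₗ[ℝ] ℝ) (s : Set X) : ℝ≥0∞ :=
  ⨅ (g : X →ᵇ ℝ) (_ : 0 ≤ g ∧ ∀ x ∈ s, 1 ≤ g x), ENNReal.ofReal (Λ g)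

lemma preOuter_le (Λ : (X →ᵇ ℝ) →ₗ[ℝ] ℝ) {s : Set X} {g : X →ᵇ ℝ} (h0 : 0 ≤ g)
    (h1 : ∀ x ∈ s, 1 ≤ g x) : preOuter Λ s ≤ ENNReal.ofReal (Λ g) :=
  iInf₂_le g ⟨h0, h1⟩

lemma preOuter_empty (Λ : (X →ᵇ ℝ) →ₗ[ℝ] ℝ) : preOuter Λ ∅ = 0 := by
  have := preOuter_le Λ (s := ∅) (g := 0) le_rfl (by simp)
  simpa using this

lemma exists_lt_of_preOuter_lt (Λ : (X →ᵇ ℝ) →ₗ[ℝ] ℝ) {s : Set X} {c : ℝ≥0∞}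
    (h : preOuter Λ s < c) :
    ∃ g : X →ᵇ ℝ, 0 ≤ g ∧ (∀ x ∈ s, 1 ≤ g x) ∧ ENNReal.ofReal (Λ g) < c := by
  unfold preOuter at h
  simp only [iInf_lt_iff] at h
  obtain ⟨g, ⟨h0, h1⟩, h2⟩ := h
  exact ⟨g, h0, h1, h2⟩

/-- The outer measure attached to a functional on bounded continuous functions. -/
noncomputable def outer (Λ : (X →ᵇ ℝ) →ₗ[ℝ] ℝ) : OuterMeasure X :=
  OuterMeasure.ofFunction (preOuter Λ) (preOuter_empty Λ)

lemma disjoint_closure_of_areSeparated {s t : Set X} (h : Metric.AreSeparated s t) :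
    Disjoint (closure s) (closure t) := by
  obtain ⟨r, hr, h⟩ := h
  rw [Set.disjoint_left]
  intro x hs ht
  have hr2 : 0 < r / 2 := ENNReal.half_pos hr
  obtain ⟨a, ha, hxa⟩ := Metric.mem_closure_iff_infEDist_zero.1 hs |> fun h0 =>
    Metric.infEDist_lt_iff.1 (h0 ▸ hr2)
  obtain ⟨b, hb, hxb⟩ := Metric.mem_closure_iff_infEDist_zero.1 ht |> fun h0 =>
    Metric.infEDist_lt_iff.1 (h0 ▸ hr2)
  have h1 : edist a b < r := by
    calc edist a b ≤ edist a x + edist x b := edist_triangle _ _ _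
      _ < r / 2 + r / 2 := ENNReal.add_lt_add (by rwa [edist_comm]) hxb
      _ = r := ENNReal.add_halves r
  exact (h a ha b hb).not_gt h1

/-- A Urysohn function `u` for the two disjoint closures splits any competitor `g` for `v` into
competitors `g * (1 - u)` and `g * u`. -/
lemma preOuter_add_le (Λ : (X →ᵇ ℝ) →ₗ[ℝ] ℝ) (hpos : ∀ f, 0 ≤ f → 0 ≤ Λ f) {s t : Set X}
    (h : Metric.AreSeparated s t) (v : Set X) :
    preOuter Λ (v ∩ s) + preOuter Λ (v ∩ t) ≤ preOuter Λ v := by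
  refine le_iInf₂ fun g hg => ?_
  obtain ⟨u, hu0, hu1, hu⟩ := exists_bounded_zero_one_of_closed isClosed_closure isClosed_closure
    (disjoint_closure_of_areSeparated h)
  have e : g = g * u + g * (1 - u) := by ring
  have p1 : 0 ≤ g * u := fun x => mul_nonneg (hg.1 x) (hu x).1
  have p2 : 0 ≤ g * (1 - u) := fun x =>
    mul_nonneg (hg.1 x) (by simpa using (hu x).2)
  calc preOuter Λ (v ∩ s) + preOuter Λ (v ∩ t)
      ≤ ENNReal.ofReal (Λ (g * (1 - u))) + ENNReal.ofReal (Λ (g * u)) := by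
        refine add_le_add (preOuter_le Λ p2 ?_) (preOuter_le Λ p1 ?_)
        · intro x hx
          have : u x = 0 := hu0 (subset_closure hx.2)
          simpa [this] using hg.2 x hx.1
        · intro x hx
          have : u x = 1 := hu1 (subset_closure hx.2)
          simpa [this] using hg.2 x hx.1
    _ = ENNReal.ofReal (Λ g) := by
        rw [← ENNReal.ofReal_add (hpos _ p2) (hpos _ p1), ← map_add, add_comm, ← e]

/-- By Carathéodory's criterion this makes Borel sets measurable for `outer Λ`. Each piece of a
cover of `s ∪ t` splits additively into its traces on `s` and `t`. -/
lemma isMetric_outer (Λ : (X →ᵇ ℝ) →ₗ[ℝ] ℝ) (hpos : ∀ f, 0 ≤ f → 0 ≤ Λ f) :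
    (outer Λ).IsMetric := by
  intro s t h
  refine le_antisymm (measure_union_le _ _) ?_
  rw [outer, OuterMeasure.ofFunction_apply _ _ (s ∪ t)]
  refine le_iInf₂ fun v hv => ?_
  have key : ∀ w : Set X, w ⊆ s ∪ t →
      OuterMeasure.ofFunction (preOuter Λ) (preOuter_empty Λ) w ≤ ∑' n, preOuter Λ (v n ∩ w) := by
    intro w hw
    rw [OuterMeasure.ofFunction_apply]
    refine iInf₂_le (fun n => v n ∩ w) ?_
    rw [← Set.iUnion_inter]
    exact fun x hx => ⟨hv (hw hx), hx⟩
  calc _ ≤ ∑' n, preOuter Λ (v n ∩ s) + ∑' n, preOuter Λ (v n ∩ t) :=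
        add_le_add (key s Set.subset_union_left) (key t Set.subset_union_right)
    _ = ∑' n, (preOuter Λ (v n ∩ s) + preOuter Λ (v n ∩ t)) := ENNReal.tsum_add.symm
    _ ≤ ∑' n, preOuter Λ (v n) := ENNReal.tsum_le_tsum fun n => preOuter_add_le Λ hpos h (v n)

lemma mono_of_nonneg (Λ : (X →ᵇ ℝ) →ₗ[ℝ] ℝ) (hpos : ∀ f, 0 ≤ f → 0 ≤ Λ f) {f g : X →ᵇ ℝ}
    (h : f ≤ g) : Λ f ≤ Λ g := by
  have := hpos (g - f) (sub_nonneg.2 h)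
  rw [map_sub] at this
  linarith

/-- Sequential continuity from above at zero of a functional on bounded continuous functions. -/
def SigmaSmooth (Λ : (X →ᵇ ℝ) → ℝ) : Prop :=
  ∀ φ : ℕ → X →ᵇ ℝ, Antitone φ → (∀ x, Tendsto (fun k => φ k x) atTop (𝓝 0)) →
    Tendsto (fun k => Λ (φ k)) atTop (𝓝 0)

/-- The positive parts of `1 - ∑ k < n, g k` decrease to zero, so smoothness makes the missing mass
vanish. Only here is smoothness used in the representation. -/
lemma one_le_tsum_of_cover (Λ : (X →ᵇ ℝ) →ₗ[ℝ] ℝ) (hpos : ∀ f, 0 ≤ f → 0 ≤ Λ f)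
    (hone : Λ 1 = 1) (hσ : SigmaSmooth Λ) (g : ℕ → X →ᵇ ℝ) (hg : ∀ k, 0 ≤ g k)
    (hcov : ∀ x, ∃ k, 1 ≤ g k x) : 1 ≤ ∑' k, ENNReal.ofReal (Λ (g k)) := by
  set φ : ℕ → X →ᵇ ℝ := fun n => (1 - ∑ k ∈ Finset.range n, g k) ⊔ 0 with hφ
  have hanti : Antitone φ := by
    refine antitone_nat_of_succ_le fun n => ?_
    refine sup_le_sup_right (sub_le_sub_left ?_ _) _
    rw [Finset.sum_range_succ]
    exact le_add_of_nonneg_right (hg n)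
  have hlim : ∀ x, Tendsto (fun k => φ k x) atTop (𝓝 0) := by
    intro x
    obtain ⟨k, hk⟩ := hcov x
    refine tendsto_const_nhds.congr' ?_
    filter_upwards [eventually_gt_atTop k] with n hn
    have : g k x ≤ ∑ i ∈ Finset.range n, g i x :=
      Finset.single_le_sum (f := fun i => g i x) (fun i _ => hg i x) (Finset.mem_range.2 hn)
    have e : φ n x = max (1 - ∑ i ∈ Finset.range n, g i x) 0 := by
      simp [hφ]
    rw [e, max_eq_right]
    linarith
  have h0 := hσ φ hanti hlim
  have hle : ∀ n, ENNReal.ofReal (1 - Λ (φ n)) ≤ ∑' k, ENNReal.ofReal (Λ (g k)) := by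
    intro n
    have h1 : Λ (1 - ∑ k ∈ Finset.range n, g k) ≤ Λ (φ n) := mono_of_nonneg Λ hpos le_sup_left
    rw [map_sub, map_sum, hone] at h1
    calc ENNReal.ofReal (1 - Λ (φ n))
        ≤ ENNReal.ofReal (∑ k ∈ Finset.range n, Λ (g k)) := ENNReal.ofReal_le_ofReal (by linarith)
      _ = ∑ k ∈ Finset.range n, ENNReal.ofReal (Λ (g k)) :=
          ENNReal.ofReal_sum_of_nonneg fun k _ => hpos _ (hg k)
      _ ≤ _ := ENNReal.sum_le_tsum _
  have h2 : Tendsto (fun n => ENNReal.ofReal (1 - Λ (φ n))) atTop (𝓝 1) := by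
    have := ENNReal.tendsto_ofReal (h0.const_sub 1)
    simpa using this
  exact le_of_tendsto' h2 hle

lemma one_le_outer_univ (Λ : (X →ᵇ ℝ) →ₗ[ℝ] ℝ) (hpos : ∀ f, 0 ≤ f → 0 ≤ Λ f)
    (hone : Λ 1 = 1) (hσ : SigmaSmooth Λ) : 1 ≤ outer Λ Set.univ := by
  rw [outer, OuterMeasure.ofFunction_apply]
  refine le_iInf₂ fun v hv => ?_
  refine ENNReal.le_of_forall_pos_le_add fun ε hε hfin => ?_
  obtain ⟨δ, hδ, hδs⟩ := ENNReal.exists_pos_sum_of_countable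
    (ENNReal.coe_pos.2 hε).ne' ℕ
  have hlt : ∀ k, preOuter Λ (v k) < preOuter Λ (v k) + δ k := fun k =>
    ENNReal.lt_add_right (ENNReal.ne_top_of_tsum_ne_top hfin.ne k)
      (ENNReal.coe_pos.2 (hδ k)).ne'
  choose g hg0 hg1 hg2 using fun k => exists_lt_of_preOuter_lt Λ (hlt k)
  calc 1 ≤ ∑' k, ENNReal.ofReal (Λ (g k)) := by
        refine one_le_tsum_of_cover Λ hpos hone hσ g hg0 fun x => ?_
        obtain ⟨k, hk⟩ := Set.mem_iUnion.1 (hv (Set.mem_univ x))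
        exact ⟨k, hg1 k x hk⟩
    _ ≤ ∑' k, (preOuter Λ (v k) + δ k) := ENNReal.tsum_le_tsum fun k => (hg2 k).le
    _ = ∑' k, preOuter Λ (v k) + ∑' k, (δ k : ℝ≥0∞) := ENNReal.tsum_add
    _ ≤ _ := by gcongr

variable [MeasurableSpace X] [BorelSpace X]

/-- Cut `f` into layers of height `δ`. Each layer is at most `δ` times the indicator of the set
where `f` reaches its base, and on that set the layer just below, divided by `δ`, equals one. The
offset of one layer costs the summand `δ`. -/
lemma integral_le_add_of_measure_le (Λ : (X →ᵇ ℝ) →ₗ[ℝ] ℝ) (hpos : ∀ f, 0 ≤ f → 0 ≤ Λ f)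
    (ν : Measure X) [IsProbabilityMeasure ν]
    (hν : ∀ (s : Set X) (g : X →ᵇ ℝ), 0 ≤ g → (∀ x ∈ s, 1 ≤ g x) → ν.real s ≤ Λ g)
    (f : X →ᵇ ℝ) (hf : 0 ≤ f) (δ : ℝ) (hδ : 0 < δ) : ∫ x, f x ∂ν ≤ δ + Λ f := by
  set h : ℕ → X →ᵇ ℝ := fun j => f ⊓ BoundedContinuousFunction.const X (j * δ) with hh
  have happ : ∀ j x, h j x = min (f x) (j * δ) := fun j x => rfl
  have hmono : ∀ j, h j ≤ h (j + 1) := by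
    intro j
    refine inf_le_inf_left _ fun x => ?_
    change (j : ℝ) * δ ≤ ((j + 1 : ℕ) : ℝ) * δ
    push_cast
    nlinarith
  have hstep : ∀ j, ∫ x, (h (j + 2) x - h (j + 1) x) ∂ν ≤ Λ (h (j + 1)) - Λ (h j) := by
    intro j
    set s : Set X := {x | ((j + 1 : ℕ) : ℝ) * δ ≤ f x} with hs
    have hsm : MeasurableSet s := (isClosed_le continuous_const f.continuous).measurableSet
    have h1 : ν.real s ≤ Λ (δ⁻¹ • (h (j + 1) - h j)) := by
      refine hν s _ ?_ ?_
      · intro x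
        have := hmono j x
        have : 0 ≤ δ⁻¹ * (h (j + 1) x - h j x) := mul_nonneg (by positivity) (sub_nonneg.2 this)
        simpa using this
      · intro x hx
        have hx' : ((j + 1 : ℕ) : ℝ) * δ ≤ f x := hx
        have hx2 : (j : ℝ) * δ ≤ f x := by push_cast at hx'; nlinarith
        have : 1 ≤ δ⁻¹ * (h (j + 1) x - h j x) := by
          rw [happ, happ, min_eq_right hx', min_eq_right hx2]
          push_cast
          field_simp
          linarith
        simpa using this
    rw [map_smul, smul_eq_mul, map_sub] at h1
    have h2 : δ * ν.real s ≤ Λ (h (j + 1)) - Λ (h j) := by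
      have := mul_le_mul_of_nonneg_left h1 hδ.le
      rwa [← mul_assoc, mul_inv_cancel₀ hδ.ne', one_mul] at this
    refine le_trans ?_ h2
    have h3 : ∫ x, s.indicator (fun _ => δ) x ∂ν = δ * ν.real s := by
      rw [integral_indicator_const _ hsm, smul_eq_mul, mul_comm]
    rw [← h3]
    refine integral_mono (((h (j + 2)).integrable ν).sub ((h (j + 1)).integrable ν))
      ((integrable_const δ).indicator hsm) fun x => ?_
    by_cases hx : x ∈ s
    · have hx' : ((j + 1 : ℕ) : ℝ) * δ ≤ f x := hx
      simp only [Set.indicator_of_mem hx, happ]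
      rw [min_eq_right hx']
      have := min_le_right (f x) (((j + 2 : ℕ) : ℝ) * δ)
      push_cast at this ⊢
      linarith
    · have hx' : f x < ((j + 1 : ℕ) : ℝ) * δ := not_le.1 hx
      simp only [Set.indicator_of_notMem hx, happ]
      rw [min_eq_left hx'.le]
      have := min_le_left (f x) (((j + 2 : ℕ) : ℝ) * δ)
      linarith
  have hind : ∀ j, ∫ x, h (j + 1) x ∂ν ≤ δ + Λ (h j) := by
    intro j
    induction j with
    | zero =>
      have h1 : ∫ x, h 1 x ∂ν ≤ ∫ _, δ ∂ν := by
        refine integral_mono ((h 1).integrable ν) (integrable_const δ) fun x => ?_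
        simp [happ]
      have h2 : 0 ≤ Λ (h 0) := hpos _ fun x => by simpa [happ] using hf x
      simp only [integral_const, probReal_univ, one_smul] at h1
      simpa using by linarith
    | succ j ih =>
      have := hstep j
      rw [integral_sub ((h (j + 2)).integrable ν) ((h (j + 1)).integrable ν)] at this
      change ∫ x, h (j + 2) x ∂ν ≤ _
      linarith
  obtain ⟨n, hn⟩ := exists_nat_ge (‖f‖ / δ)
  have hn' : ‖f‖ ≤ n * δ := by rwa [div_le_iff₀ hδ] at hn
  have hfn : h n = f := by
    ext x
    rw [happ, min_eq_left]
    exact (le_abs_self _).trans ((f.norm_coe_le_norm x).trans hn')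
  have hfn' : h (n + 1) = f := by
    refine le_antisymm inf_le_left ?_
    conv_lhs => rw [← hfn]
    exact hmono n
  have := hind n
  rwa [hfn, hfn'] at this

/-- Daniell representation on a metric space: a positive normalized functional on bounded
continuous functions that is continuous along decreasing sequences is integration against a Borel
probability measure. -/
theorem exists_isProbabilityMeasure_integral_eq (Λ : (X →ᵇ ℝ) →ₗ[ℝ] ℝ)
    (hpos : ∀ f, 0 ≤ f → 0 ≤ Λ f) (hone : Λ 1 = 1) (hσ : SigmaSmooth Λ) :
    ∃ ν : Measure X, IsProbabilityMeasure ν ∧ ∀ f : X →ᵇ ℝ, ∫ x, f x ∂ν = Λ f := by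
  have hb : ‹MeasurableSpace X› ≤ (outer Λ).caratheodory := by
    rw [BorelSpace.measurable_eq (α := X)]
    exact (isMetric_outer Λ hpos).borel_le_caratheodory
  set ν := (outer Λ).toMeasure hb with hνdef
  have hle : ∀ (s : Set X) (g : X →ᵇ ℝ), MeasurableSet s → 0 ≤ g → (∀ x ∈ s, 1 ≤ g x) →
      ν s ≤ ENNReal.ofReal (Λ g) := by
    intro s g hs h0 h1
    rw [hνdef, toMeasure_apply _ _ hs]
    exact (OuterMeasure.ofFunction_le s).trans (preOuter_le Λ h0 h1)
  have hprob : IsProbabilityMeasure ν := by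
    refine ⟨le_antisymm ?_ ?_⟩
    · simpa [hone] using hle Set.univ 1 .univ (fun _ => zero_le_one) (by simp)
    · rw [hνdef, toMeasure_apply _ _ .univ]
      exact one_le_outer_univ Λ hpos hone hσ
  have hreal : ∀ (s : Set X) (g : X →ᵇ ℝ), 0 ≤ g → (∀ x ∈ s, 1 ≤ g x) → ν.real s ≤ Λ g := by
    intro s g h0 h1
    have hm : MeasurableSet {x | 1 ≤ g x} :=
      (isClosed_le continuous_const g.continuous).measurableSet
    refine ENNReal.toReal_le_of_le_ofReal (hpos g h0) ?_
    exact (measure_mono fun x hx => h1 x hx).trans (hle {x | 1 ≤ g x} g hm h0 fun x hx => hx)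
  have hnonneg : ∀ f : X →ᵇ ℝ, 0 ≤ f → ∫ x, f x ∂ν ≤ Λ f := fun f hf =>
    le_of_forall_pos_le_add fun δ hδ => by
      rw [add_comm]
      exact integral_le_add_of_measure_le Λ hpos ν hreal f hf δ hδ
  have hall : ∀ f : X →ᵇ ℝ, ∫ x, f x ∂ν ≤ Λ f := by
    intro f
    -- Adding `‖f‖` makes the function nonnegative, and the constant cancels because `Λ` and `ν` are
    -- normalized.
    have h1 := hnonneg (f + ‖f‖ • (1 : X →ᵇ ℝ)) fun x => by
      have := neg_le_of_abs_le (f.norm_coe_le_norm x)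
      simpa using by linarith
    rw [map_add, map_smul, hone] at h1
    simp only [BoundedContinuousFunction.coe_add, BoundedContinuousFunction.coe_smul,
      BoundedContinuousFunction.coe_one, Pi.add_apply, Pi.one_apply, smul_eq_mul, mul_one] at h1
    rw [integral_add (f.integrable ν) (integrable_const _)] at h1
    simpa using h1
  refine ⟨ν, hprob, fun f => le_antisymm (hall f) ?_⟩
  have := hall (-f)
  simp only [BoundedContinuousFunction.coe_neg, Pi.neg_apply, integral_neg, map_neg] at this
  linarith

end DaniellMetric

/-! ### Subseries and Baire category -/

section Subseries

variable {X : Type*} [TopologicalSpace X]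

lemma lowerSemicontinuous_of_hasSum {f : ℕ → X → ℝ} {F : X → ℝ} (hf : ∀ i, Continuous (f i))
    (h0 : ∀ i x, 0 ≤ f i x) (hF : ∀ x, HasSum (fun i => f i x) (F x)) :
    LowerSemicontinuous F := by
  intro x y hy
  obtain ⟨s, hs⟩ := ((hF x).eventually (lt_mem_nhds hy)).exists
  have hc : Continuous fun x => ∑ i ∈ s, f i x := continuous_finsetSum s fun i _ => hf i
  filter_upwards [hc.continuousAt.eventually (lt_mem_nhds hs)] with x' hx'
  exact hx'.trans_le (sum_le_hasSum s (fun i _ => h0 i x') (hF x'))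

/-- `F` and `G` are both lower semicontinuous, so `F = (F + G) - G` is upper semicontinuous too. -/
lemma continuous_of_hasSum_of_continuous_add {f g : ℕ → X → ℝ} {F G : X → ℝ}
    (hf : ∀ i, Continuous (f i)) (hf0 : ∀ i x, 0 ≤ f i x)
    (hF : ∀ x, HasSum (fun i => f i x) (F x))
    (hg : ∀ i, Continuous (g i)) (hg0 : ∀ i x, 0 ≤ g i x)
    (hG : ∀ x, HasSum (fun i => g i x) (G x))
    (hFG : Continuous (F + G)) : Continuous F := by
  rw [continuous_iff_lower_upperSemicontinuous]
  refine ⟨lowerSemicontinuous_of_hasSum hf hf0 hF, ?_⟩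
  have h1 : UpperSemicontinuous (-G) := by
    have := lowerSemicontinuous_of_hasSum hg hg0 hG
    intro x y hy
    have hy' : -y < G x := by simp only [Pi.neg_apply] at hy; linarith
    filter_upwards [this x (-y) hy'] with x' hx'
    simp only [Pi.neg_apply]; linarith
  have h2 := hFG.upperSemicontinuous.add h1
  have e : F = fun x => (F + G) x + (-G) x := by ext x; simp
  rw [e]; exact h2

/-- If a series of nonnegative continuous functions has a bounded continuous sum, then all its
subseries have bounded continuous sums. -/
lemma exists_subseries (f : ℕ → X →ᵇ ℝ) (h0 : ∀ i, 0 ≤ f i) (Φ : X →ᵇ ℝ)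
    (hΦ : ∀ x, HasSum (fun i => f i x) (Φ x)) :
    ∃ F : (ℕ → Bool) → X →ᵇ ℝ, ∀ J x, HasSum (fun i => if J i then f i x else 0) (F J x) := by
  have hsum : ∀ (J : ℕ → Bool) x, Summable fun i => if J i then f i x else 0 := fun J x =>
    (hΦ x).summable.of_nonneg_of_le (fun i => by split_ifs; exacts [h0 i x, le_rfl])
      fun i => by split_ifs; exacts [le_rfl, h0 i x]
  have hnn : ∀ (J : ℕ → Bool) i x, 0 ≤ (if J i then f i x else 0) := fun J i x => by
    split_ifs; exacts [h0 i x, le_rfl]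
  have hcont : ∀ (J : ℕ → Bool) i, Continuous fun x => if J i then f i x else 0 := fun J i => by
    split_ifs; exacts [(f i).continuous, continuous_const]
  have hadd : ∀ (J : ℕ → Bool) x, (∑' i, if J i then f i x else 0)
      + (∑' i, if !J i then f i x else 0) = Φ x := fun J x => by
    rw [← (hΦ x).tsum_eq, ← (hsum J x).tsum_add (hsum (fun i => !J i) x)]
    refine tsum_congr fun i => ?_
    cases J i <;> simp
  refine ⟨fun J => BoundedContinuousFunction.ofNormedAddCommGroup
    (fun x => ∑' i, if J i then f i x else 0) ?_ ‖Φ‖ fun x => ?_, fun J x => (hsum J x).hasSum⟩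
  · refine continuous_of_hasSum_of_continuous_add (hcont J) (hnn J) (fun x => (hsum J x).hasSum)
      (hcont fun i => !J i) (hnn fun i => !J i) (fun x => (hsum (fun i => !J i) x).hasSum) ?_
    exact Φ.continuous.congr fun x => (hadd J x).symm
  · rw [Real.norm_of_nonneg (tsum_nonneg fun i => hnn J i x)]
    have h1 := hadd J x
    have h2 : 0 ≤ ∑' i, if !J i then f i x else 0 := tsum_nonneg fun i => hnn (fun i => !J i) i x
    have h3 := (le_abs_self _).trans (Φ.norm_coe_le_norm x)
    linarith

/-- Continuity in the index set `J` makes the sets in the Baire argument closed. -/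
lemma continuous_integral_subseries [MeasurableSpace X] [OpensMeasurableSpace X]
    (f : ℕ → X →ᵇ ℝ) (h0 : ∀ i, 0 ≤ f i) (Φ : X →ᵇ ℝ)
    (hΦ : ∀ x, HasSum (fun i => f i x) (Φ x)) (F : (ℕ → Bool) → X →ᵇ ℝ)
    (hF : ∀ J x, HasSum (fun i => if J i then f i x else 0) (F J x))
    (m : Measure X) [IsFiniteMeasure m] : Continuous fun J => ∫ x, F J x ∂m := by
  have hnn : ∀ (J : ℕ → Bool) i x, 0 ≤ (if J i then f i x else 0) := fun J i x => by
    split_ifs; exacts [h0 i x, le_rfl]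
  have hle : ∀ (J : ℕ → Bool) i x, (if J i then f i x else 0) ≤ f i x := fun J i x => by
    split_ifs; exacts [le_rfl, h0 i x]
  refine continuous_of_dominated (bound := Φ) (fun J => (F J).continuous.aestronglyMeasurable)
    (fun J => .of_forall fun x => ?_) (Φ.integrable m) (.of_forall fun x => ?_)
  · rw [Real.norm_of_nonneg ((hF J x).nonneg fun i => hnn J i x)]
    exact hasSum_le (fun i => hle J i x) (hF J x) (hΦ x)
  · have e : (fun J => F J x) = fun J : ℕ → Bool => ∑' i, if J i then f i x else 0 :=
      funext fun J => (hF J x).tsum_eq.symm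
    rw [e]
    refine continuous_tsum (fun i => ?_) (hΦ x).summable fun i J => ?_
    · exact (continuous_of_discreteTopology (f := fun b : Bool => if b then f i x else 0)).comp
        (continuous_apply i)
    · rw [Real.norm_of_nonneg (hnn J i x)]; exact hle J i x

end Subseries

/-- Equicontinuity at a point for every bounded continuous test function is uniform over almost all
terms of a series of nonnegative functions with bounded continuous sum. -/
lemma exists_uniform_equicontinuity {X ι : Type*} [PseudoMetricSpace X] [MeasurableSpace X]
    [OpensMeasurableSpace X] (κ : ι → X → Measure X) [∀ n x, IsProbabilityMeasure (κ n x)] (z : X)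
    (hequi : ∀ φ : X →ᵇ ℝ, EquicontinuousAt (fun (n : ι) (x : X) => ∫ y, φ y ∂(κ n x)) z)
    (f : ℕ → X →ᵇ ℝ) (h0 : ∀ i, 0 ≤ f i) (Φ : X →ᵇ ℝ)
    (hΦ : ∀ x, HasSum (fun i => f i x) (Φ x)) {η : ℝ} (hη : 0 < η) :
    ∃ δ > 0, ∃ M : ℕ, ∀ i ≥ M, ∀ x ∈ Metric.ball z δ, ∀ n,
      |∫ y, f i y ∂(κ n x) - ∫ y, f i y ∂(κ n z)| ≤ η := by
  obtain ⟨F, hF⟩ := exists_subseries f h0 Φ hΦ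
  have hc := fun n x => continuous_integral_subseries f h0 Φ hΦ F hF (κ n x)
  -- The bound is `η / 2` because `f i` will be a difference of two subseries.
  set C : ℕ → Set (ℕ → Bool) := fun k => {J | ∀ x ∈ Metric.ball z (1 / (k + 1 : ℝ)), ∀ n,
    |∫ y, F J y ∂(κ n x) - ∫ y, F J y ∂(κ n z)| ≤ η / 2} with hC
  have hclosed : ∀ k, IsClosed (C k) := by
    intro k
    simp only [hC, Set.ofPred_forall]
    exact isClosed_iInter fun x => isClosed_iInter fun _ => isClosed_iInter fun n =>
      isClosed_le ((hc n x).sub (hc n z)).abs continuous_const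
  have hcover : ⋃ k, C k = Set.univ := by
    refine Set.eq_univ_of_forall fun J => ?_
    obtain ⟨δ, hδ, h⟩ := Metric.equicontinuousAt_iff.1 (hequi (F J)) (η / 2) (half_pos hη)
    obtain ⟨k, hk⟩ := exists_nat_one_div_lt hδ
    refine Set.mem_iUnion.2 ⟨k, fun x hx n => ?_⟩
    have := h x ((Metric.mem_ball.1 hx).trans hk) n
    rw [Real.dist_eq, abs_sub_comm] at this
    exact this.le
  obtain ⟨k, J, hJ⟩ := nonempty_interior_of_iUnion_of_closed hclosed hcover
  obtain ⟨I, u, hu, hsub⟩ := isOpen_pi_iff.1 isOpen_interior J hJ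
  -- The interior of `C k` contains a cylinder constraining only coordinates in `I`; any later
  -- coordinate `i` can be flipped without leaving it, and the flip isolates `f i`.
  refine ⟨1 / (k + 1 : ℝ), by positivity, I.sup id + 1, fun i hi x hx n => ?_⟩
  have hiI : i ∉ I := fun h => by
    have : id i ≤ I.sup id := Finset.le_sup h
    simp only [id] at this
    omega
  have hmem : ∀ b, Function.update J i b ∈ C k := by
    intro b
    refine interior_subset (hsub fun j hj => ?_)
    have : j ≠ i := fun h => hiI (h ▸ hj)
    rw [Function.update_of_ne this]
    exact (hu j hj).2
  have hdiff : ∀ y, f i y = F (Function.update J i true) y - F (Function.update J i false) y := by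
    intro y
    have h1 := (hF (Function.update J i true) y).sub (hF (Function.update J i false) y)
    refine (hasSum_ite_eq i (f i y)).unique (h1.congr_fun ?_)
    intro j
    by_cases hj : j = i
    · subst hj; simp
    · simp [hj]
  have hint : ∀ x, ∫ y, f i y ∂(κ n x) = ∫ y, F (Function.update J i true) y ∂(κ n x)
      - ∫ y, F (Function.update J i false) y ∂(κ n x) := fun x => by
    rw [← integral_sub (BoundedContinuousFunction.integrable _ _)
      (BoundedContinuousFunction.integrable _ _)]
    exact integral_congr_ae (.of_forall hdiff)
  have h1 := abs_le.1 (hmem true x hx n)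
  have h2 := abs_le.1 (hmem false x hx n)
  rw [hint x, hint z, abs_le]
  constructor <;> linarith

/-! ### Iterates of a Markov kernel -/

section Chain

variable {X : Type*} [MeasurableSpace X]

instance isMarkovKernel_pow (π : Kernel X X) [IsMarkovKernel π] (n : ℕ) :
    IsMarkovKernel (π ^ n) := by
  induction n with
  | zero => rw [pow_zero]; exact inferInstanceAs (IsMarkovKernel Kernel.id)
  | succ n ih => rw [pow_succ]; exact inferInstanceAs (IsMarkovKernel ((π ^ n) ∘ₖ π))

lemma bind_pow_add (π : Kernel X X) (μ : Measure X) (l n : ℕ) :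
    μ.bind (π ^ (l + n)) = (μ.bind (π ^ l)).bind (π ^ n) := by
  rw [Measure.comp_assoc, add_comm, Kernel.pow_add]

lemma abs_integral_le_norm [TopologicalSpace X] (m : Measure X) [IsProbabilityMeasure m] (f : X →ᵇ ℝ) :
    |∫ x, f x ∂m| ≤ ‖f‖ := by
  have := norm_integral_le_of_norm_le_const (μ := m) (f := f) (C := ‖f‖)
    (.of_forall f.norm_coe_le_norm)
  simpa using this

variable [TopologicalSpace X] [OpensMeasurableSpace X]

lemma integrable_integral_kernel (κ : Kernel X X) [IsMarkovKernel κ] (m : Measure X)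
    [IsFiniteMeasure m] (f : X →ᵇ ℝ) : Integrable (fun x => ∫ y, f y ∂(κ x)) m := by
  have h : Integrable f ((κ ∘ₖ Kernel.const Unit m) ()) := f.integrable _
  simpa using h.integral_comp

lemma integral_bind_boundedContinuous (κ : Kernel X X) [IsMarkovKernel κ] (m : Measure X)
    [IsFiniteMeasure m] (f : X →ᵇ ℝ) : ∫ y, f y ∂(m.bind κ) = ∫ x, ∫ y, f y ∂(κ x) ∂m := by
  have h : Integrable f ((κ ∘ₖ Kernel.const Unit m) ()) := f.integrable _
  rw [Measure.comp_eq_comp_const_apply, Kernel.integral_comp h, Kernel.const_apply]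

end Chain

/-! ### Time averages and uniform decay from `z` -/

/-- The excess is at most `n` boundary terms, so a fixed delay is negligible in time averages. -/
lemma sum_range_shift_le (u : ℕ → ℝ) {C : ℝ} (h0 : ∀ l, 0 ≤ u l) (hC : ∀ l, u l ≤ C) (T n : ℕ) :
    ∑ l ∈ Finset.range T, u (l + n) ≤ ∑ l ∈ Finset.range T, u l + n * C := by
  induction n with
  | zero => simp
  | succ n ih =>
    have h1 := Finset.sum_range_succ (fun l => u (l + n)) T
    have h2 := Finset.sum_range_succ' (fun l => u (l + n)) T
    have h3 : ∀ l, u (l + 1 + n) = u (l + (n + 1)) := fun l => by congr 1; omega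
    simp only [h3] at h2
    have := h0 (0 + n)
    have := hC (T + n)
    push_cast
    linarith

/-- A positive lower bound for the average time spent in a ball, in terms of real-valued masses. -/
lemma exists_pos_eventually_le_sum {X : Type*} [MeasurableSpace X] (π : Kernel X X)
    [IsMarkovKernel π] (μ : Measure X) [IsProbabilityMeasure μ] {B : Set X} (hB : MeasurableSet B)
    (h : 0 < liminf (fun n : ℕ =>
        (n : ℝ≥0∞)⁻¹ * ∑ i ∈ Finset.Icc 1 n, ∫⁻ x, (π ^ i) x B ∂μ) atTop) :
    ∃ c : ℝ, 0 < c ∧ ∀ᶠ T : ℕ in atTop,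
      c * T ≤ ∑ l ∈ Finset.range T, (μ.bind (π ^ (l + 1))).real B := by
  obtain ⟨c, hc0, hc⟩ := ENNReal.lt_iff_exists_real_btwn.1 h
  obtain ⟨hc1, hc2⟩ := hc
  refine ⟨c, by simpa using hc1, ?_⟩
  filter_upwards [eventually_lt_of_lt_liminf hc2, eventually_gt_atTop 0] with T hT hT0
  have hT' : (T : ℝ≥0∞) ≠ 0 := by simpa using hT0.ne'
  have e : ∑ i ∈ Finset.Icc 1 T, ∫⁻ x, (π ^ i) x B ∂μ
      = ENNReal.ofReal (∑ l ∈ Finset.range T, (μ.bind (π ^ (l + 1))).real B) := by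
    rw [ENNReal.ofReal_sum_of_nonneg fun _ _ => measureReal_nonneg]
    rw [← Finset.Ico_add_one_right_eq_Icc, Finset.sum_Ico_eq_sum_range]
    refine Finset.sum_congr (by simp) fun l _ => ?_
    rw [ofReal_measureReal, Measure.bind_apply hB (Kernel.aemeasurable _), add_comm]
  rw [e, mul_comm, ← div_eq_mul_inv, ENNReal.lt_div_iff_mul_lt (Or.inl hT') (Or.inl (by simp)),
    ← ENNReal.ofReal_natCast, ← ENNReal.ofReal_mul hc0] at hT
  exact (ENNReal.ofReal_le_ofReal_iff
    (Finset.sum_nonneg fun _ _ => measureReal_nonneg)).1 hT.le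

section Recurrence

variable {X : Type*} [MetricSpace X] [MeasurableSpace X] [BorelSpace X]

/-- Mass started at `z` cannot be found on infinitely many terms of a series of nonnegative
functions with bounded continuous sum. -/
lemma false_of_forall_le_integral (π : Kernel X X) [IsMarkovKernel π] (z : X)
    (μ : Measure X) [IsProbabilityMeasure μ]
    (hpos : ∀ ε : ℝ, 0 < ε →
      0 < liminf (fun n : ℕ =>
        (n : ℝ≥0∞)⁻¹ * ∑ i ∈ Finset.Icc 1 n, ∫⁻ x, (π ^ i) x (Metric.ball z ε) ∂μ) atTop)
    (hequi : ∀ φ : X →ᵇ ℝ,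
      EquicontinuousAt (fun (n : ℕ) (x : X) => ∫ y, φ y ∂((π ^ n) x)) z)
    (f : ℕ → X →ᵇ ℝ) (h0 : ∀ i, 0 ≤ f i) (Φ : X →ᵇ ℝ)
    (hΦ : ∀ x, HasSum (fun i => f i x) (Φ x)) {ε : ℝ} (hε : 0 < ε) (N : ℕ → ℕ)
    (hN : ∀ i, ε ≤ ∫ y, f i y ∂((π ^ N i) z)) : False := by
  obtain ⟨δ, hδ, M, hM⟩ := exists_uniform_equicontinuity (fun n x => (π ^ n) x) z hequi f h0 Φ hΦ
    (half_pos hε)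
  obtain ⟨c, hc, hcT⟩ := exists_pos_eventually_le_sum π μ Metric.isOpen_ball.measurableSet
    (hpos δ hδ)
  set B := Metric.ball z δ with hB
  have hBm : MeasurableSet B := Metric.isOpen_ball.measurableSet
  set m : ℕ → Measure X := fun l => μ.bind (π ^ (l + 1) : Kernel X X) with hm
  have hmp : ∀ l, IsProbabilityMeasure (m l) := fun l => by
    simp only [hm]; infer_instance
  set b : ℕ → ℕ → ℝ := fun i l => ∫ y, f i y ∂(m l) with hb
  have hb0 : ∀ i l, 0 ≤ b i l := fun i l => integral_nonneg (h0 i)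
  have hsum : ∀ (s : Finset ℕ) l, ∑ i ∈ s, b i l ≤ ‖Φ‖ := by
    intro s l
    rw [hb, ← integral_finsetSum s fun i _ => (f i).integrable (m l)]
    calc ∫ y, ∑ i ∈ s, f i y ∂(m l) ≤ ∫ _, ‖Φ‖ ∂(m l) := by
          refine integral_mono (integrable_finsetSum s fun i _ => (f i).integrable (m l))
            (integrable_const _) fun y => ?_
          exact (sum_le_hasSum s (fun i _ => h0 i y) (hΦ y)).trans
            ((le_abs_self _).trans (Φ.norm_coe_le_norm y))
      _ = ‖Φ‖ := by simp
  have hbC : ∀ i l, b i l ≤ ‖Φ‖ := fun i l => by simpa using hsum {i} l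
  have hlow : ∀ i ≥ M, ∀ l, ε / 2 * (m l).real B ≤ b i (l + N i) := by
    intro i hi l
    have e : b i (l + N i) = ∫ x, ∫ y, f i y ∂((π ^ N i) x) ∂(m l) := by
      rw [← integral_bind_boundedContinuous, hm, ← bind_pow_add, Nat.add_right_comm]
    have e2 : ∫ x, B.indicator (fun _ => ε / 2) x ∂(m l) = ε / 2 * (m l).real B := by
      rw [integral_indicator_const _ hBm, smul_eq_mul, mul_comm]
    rw [e, ← e2]
    refine integral_mono ((integrable_const _).indicator hBm)
      (integrable_integral_kernel _ _ _) fun x => ?_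
    by_cases hx : x ∈ B
    · have h1 := (abs_le.1 (hM i hi x hx (N i))).1
      have h2 := hN i
      simp only [Set.indicator_of_mem hx]
      linarith
    · simp only [Set.indicator_of_notMem hx]
      exact integral_nonneg (h0 i)
  -- `K` functions of average mass at least `ε / 2 * c` total at least `‖Φ‖ + 1`, against the bound
  -- `‖Φ‖`. The delays cost only `D`, independent of `T`.
  obtain ⟨K, hK⟩ := exists_nat_ge ((‖Φ‖ + 1) / (ε / 2 * c))
  rw [div_le_iff₀ (by positivity)] at hK
  set S := Finset.Ico M (M + K) with hS
  set D : ℝ := ∑ i ∈ S, (N i : ℝ) * ‖Φ‖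
  have hbound : ∀ᶠ T : ℕ in atTop, (T : ℝ) ≤ D := by
    filter_upwards [hcT] with T hT
    have h1 : ∀ i ∈ S, ε / 2 * (c * T) ≤ ∑ l ∈ Finset.range T, b i l + N i * ‖Φ‖ := by
      intro i hi
      calc ε / 2 * (c * T) ≤ ε / 2 * ∑ l ∈ Finset.range T, (m l).real B := by gcongr
        _ = ∑ l ∈ Finset.range T, ε / 2 * (m l).real B := Finset.mul_sum _ _ _
        _ ≤ ∑ l ∈ Finset.range T, b i (l + N i) :=
            Finset.sum_le_sum fun l _ => hlow i (Finset.mem_Ico.1 hi).1 l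
        _ ≤ _ := sum_range_shift_le (b i) (hb0 i) (hbC i) T (N i)
    have h2 := Finset.sum_le_sum h1
    rw [Finset.sum_add_distrib, Finset.sum_comm, Finset.sum_const, hS, Nat.card_Ico,
      Nat.add_sub_cancel_left, nsmul_eq_mul] at h2
    have h3 : ∑ l ∈ Finset.range T, ∑ i ∈ S, b i l ≤ T * ‖Φ‖ := by
      calc _ ≤ ∑ l ∈ Finset.range T, ‖Φ‖ := Finset.sum_le_sum fun l _ => hsum S l
        _ = _ := by simp
    have h4 : (‖Φ‖ + 1) * T ≤ K * (ε / 2 * c) * T := by gcongr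
    have h5 : (K : ℝ) * (ε / 2 * (c * T)) = K * (ε / 2 * c) * T := by ring
    rw [h5] at h2
    linarith
  obtain ⟨T, hT, hT2⟩ := (hbound.and
    (tendsto_natCast_atTop_atTop.eventually_gt_atTop D)).exists
  exact hT.not_gt hT2

/-- Integrals of a sequence of bounded continuous functions decreasing to zero, with respect to the
transition probabilities from `z`, tend to zero uniformly in time. -/
lemma exists_forall_integral_le (π : Kernel X X) [IsMarkovKernel π] (z : X)
    (μ : Measure X) [IsProbabilityMeasure μ]
    (hpos : ∀ ε : ℝ, 0 < ε →
      0 < liminf (fun n : ℕ =>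
        (n : ℝ≥0∞)⁻¹ * ∑ i ∈ Finset.Icc 1 n, ∫⁻ x, (π ^ i) x (Metric.ball z ε) ∂μ) atTop)
    (hequi : ∀ φ : X →ᵇ ℝ,
      EquicontinuousAt (fun (n : ℕ) (x : X) => ∫ y, φ y ∂((π ^ n) x)) z)
    (φ : ℕ → X →ᵇ ℝ) (hφ : Antitone φ) (hlim : ∀ x, Tendsto (fun k => φ k x) atTop (𝓝 0))
    {ε : ℝ} (hε : 0 < ε) : ∃ k, ∀ n, ∫ y, φ k y ∂((π ^ n) z) ≤ ε := by
  by_contra! hcon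
  choose N hN using hcon
  have hanti : ∀ x, Antitone fun k => φ k x := fun x i j hij => hφ hij x
  have hnn : ∀ k x, 0 ≤ φ k x := fun k x => (hanti x).le_of_tendsto (hlim x) k
  have hint : ∀ n, Tendsto (fun k => ∫ y, φ k y ∂((π ^ n) z)) atTop (𝓝 0) := by
    intro n
    have := tendsto_integral_of_dominated_convergence (μ := (π ^ n) z) (f := fun _ => (0 : ℝ))
      (F := fun k y => φ k y) (φ 0) (fun k => (φ k).continuous.aestronglyMeasurable)
      ((φ 0).integrable _) (fun k => .of_forall fun y => ?_) (.of_forall hlim)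
    · simpa using this
    · rw [Real.norm_of_nonneg (hnn k y)]
      exact hanti y (Nat.zero_le k)
  -- At the same time `N k`, a later `φ j` keeps at most `ε / 2`, so `φ k - φ j` retains at least `ε
  -- / 2`.
  have hnext : ∀ k, ∃ j > k, ∫ y, φ j y ∂((π ^ N k) z) ≤ ε / 2 := fun k => by
    have := (hint (N k)).eventually_lt_const (half_pos hε)
    obtain ⟨j, hj1, hj2⟩ := (this.and (eventually_gt_atTop k)).exists
    exact ⟨j, hj2, hj1.le⟩
  choose J hJ hJ2 using hnext
  set k : ℕ → ℕ := fun i => J^[i] 0 with hk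
  have hks : ∀ i, k (i + 1) = J (k i) := fun i => Function.iterate_succ_apply' J i 0
  have hkm : StrictMono k := strictMono_nat_of_lt_succ fun i => by rw [hks]; exact hJ _
  have hf0 : ∀ i, 0 ≤ φ (k i) - φ (k (i + 1)) := fun i =>
    sub_nonneg.2 (hφ (hkm (Nat.lt_succ_self i)).le)
  refine false_of_forall_le_integral π z μ hpos hequi (fun i => φ (k i) - φ (k (i + 1))) hf0
    (φ (k 0)) (fun x => ?_) (half_pos hε) (fun i => N (k i)) fun i => ?_
  · have hnn' : ∀ i, 0 ≤ (φ (k i) - φ (k (i + 1))) x := fun i => hf0 i x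
    rw [hasSum_iff_tendsto_nat_of_nonneg hnn']
    have h1 := ((hlim x).comp hkm.tendsto_atTop).const_sub (φ (k 0) x)
    rw [sub_zero] at h1
    refine h1.congr fun n => ?_
    exact (Finset.sum_range_sub' (fun i => φ (k i) x) n).symm
  · simp only [BoundedContinuousFunction.coe_sub, Pi.sub_apply]
    rw [integral_sub ((φ _).integrable _) ((φ _).integrable _)]
    have h1 := hN (k i)
    have h2 := hJ2 (k i)
    rw [← hks] at h2
    linarith

end Recurrence

/-! ### Limits of Cesàro averages and the invariant measure -/

/-- Pointwise limits along an ultrafilter of contractive linear functionals exist and are linear. -/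
lemma exists_linearMap_tendsto_ultrafilter {E ι : Type*} [SeminormedAddCommGroup E]
    [NormedSpace ℝ E] (U : Ultrafilter ι) (L : ι → E →ₗ[ℝ] ℝ) (hL : ∀ n f, |L n f| ≤ ‖f‖) :
    ∃ Λ : E →ₗ[ℝ] ℝ, ∀ f, Tendsto (fun n => L n f) U (𝓝 (Λ f)) := by
  have h : ∀ f, ∃ a, Tendsto (fun n => L n f) U (𝓝 a) := by
    intro f
    obtain ⟨a, -, ha⟩ := (isCompact_Icc (a := -‖f‖) (b := ‖f‖)).ultrafilter_le_nhds
      (U.map fun n => L n f) (le_principal_iff.2 (Filter.mem_map.2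
        (Eventually.of_forall fun n => abs_le.1 (hL n f))))
    exact ⟨a, ha⟩
  choose a ha using h
  refine ⟨⟨⟨a, fun f g => ?_⟩, fun c f => ?_⟩, ha⟩
  · exact tendsto_nhds_unique (ha (f + g)) (((ha f).add (ha g)).congr fun n => by simp)
  · exact tendsto_nhds_unique (ha (c • f)) (((ha f).const_mul c).congr fun n => by simp)

section InvariantMeasure

variable {X : Type*} [MetricSpace X] [MeasurableSpace X] [BorelSpace X]

/-- Integration of bounded continuous functions against a probability measure. -/
noncomputable def integralFunctional (m : Measure X) [IsProbabilityMeasure m] :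
    (X →ᵇ ℝ) →ₗ[ℝ] ℝ where
  toFun f := ∫ x, f x ∂m
  map_add' f g := integral_add (f.integrable m) (g.integrable m)
  map_smul' c f := integral_const_mul c f

/-- The Cesàro averages of the transition probabilities, as functionals. -/
noncomputable def cesaro (π : Kernel X X) [IsMarkovKernel π] (z : X) (n : ℕ) :
    (X →ᵇ ℝ) →ₗ[ℝ] ℝ :=
  ((n : ℝ) + 1)⁻¹ • ∑ i ∈ Finset.range (n + 1), integralFunctional ((π ^ i) z)

lemma cesaro_apply (π : Kernel X X) [IsMarkovKernel π] (z : X) (n : ℕ) (f : X →ᵇ ℝ) :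
    cesaro π z n f = ((n : ℝ) + 1)⁻¹ * ∑ i ∈ Finset.range (n + 1), ∫ y, f y ∂((π ^ i) z) := by
  simp [cesaro, integralFunctional]

lemma cesaro_le (π : Kernel X X) [IsMarkovKernel π] (z : X) (n : ℕ) (f : X →ᵇ ℝ) {C : ℝ}
    (h : ∀ i, ∫ y, f y ∂((π ^ i) z) ≤ C) : cesaro π z n f ≤ C := by
  rw [cesaro_apply, inv_mul_le_iff₀ (by positivity)]
  calc _ ≤ ∑ i ∈ Finset.range (n + 1), C := Finset.sum_le_sum fun i _ => h i
    _ = _ := by simp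

lemma abs_cesaro_le (π : Kernel X X) [IsMarkovKernel π] (z : X) (n : ℕ) (f : X →ᵇ ℝ) :
    |cesaro π z n f| ≤ ‖f‖ := by
  refine abs_le'.2 ⟨cesaro_le π z n f fun i =>
    (le_abs_self _).trans (abs_integral_le_norm _ f), ?_⟩
  rw [← map_neg]
  refine cesaro_le π z n (-f) fun i => ?_
  simpa using (le_abs_self _).trans (abs_integral_le_norm ((π ^ i) z) (-f))

/-- Integrating `g` advances the chain one step, so the sums telescope to two terms bounded by
`‖f‖`. -/
lemma tendsto_cesaro_sub (π : Kernel X X) [IsMarkovKernel π] (z : X) (f g : X →ᵇ ℝ)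
    (hg : ∀ x, g x = ∫ y, f y ∂(π x)) :
    Tendsto (fun n => cesaro π z n g - cesaro π z n f) atTop (𝓝 0) := by
  have hstep : ∀ i, ∫ y, g y ∂((π ^ i) z) = ∫ y, f y ∂((π ^ (i + 1)) z) := by
    intro i
    have h1 : (π ^ (i + 1)) z = ((π ^ i) z).bind π := by
      rw [add_comm, Kernel.pow_add, pow_one, Kernel.comp_apply]
    rw [h1, integral_bind_boundedContinuous]
    exact integral_congr_ae (.of_forall hg)
  have hb : ∀ n, |cesaro π z n g - cesaro π z n f| ≤ 2 * ‖f‖ * (1 / ((n : ℝ) + 1)) := by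
    intro n
    rw [cesaro_apply, cesaro_apply, ← mul_sub, ← Finset.sum_sub_distrib]
    simp only [hstep]
    rw [Finset.sum_range_sub (fun i => ∫ y, f y ∂((π ^ i) z)), abs_mul,
      abs_of_pos (by positivity : (0 : ℝ) < ((n : ℝ) + 1)⁻¹), mul_comm, one_div]
    gcongr
    refine (abs_sub _ _).trans ?_
    have h1 := abs_integral_le_norm ((π ^ (n + 1)) z) f
    have h2 := abs_integral_le_norm ((π ^ 0) z) f
    linarith
  refine squeeze_zero_norm hb ?_
  simpa using tendsto_one_div_add_atTop_nhds_zero_nat.const_mul (2 * ‖f‖)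

end InvariantMeasure

theorem theorem3p7 {X : Type*} [MetricSpace X] [MeasurableSpace X] [BorelSpace X]
    (π : Kernel X X) [IsMarkovKernel π] (hFeller : IsFellerKernel π)
    (z : X) (μ : Measure X) [IsProbabilityMeasure μ]
    (hpos : ∀ ε : ℝ, 0 < ε →
      0 < liminf (fun n : ℕ =>
        (n : ℝ≥0∞)⁻¹ * ∑ i ∈ Finset.Icc 1 n, ∫⁻ x, (π ^ i) x (Metric.ball z ε) ∂μ) atTop)
    (hequi : ∀ φ : X →ᵇ ℝ,
      EquicontinuousAt (fun (n : ℕ) (x : X) => ∫ y, φ y ∂((π ^ n) x)) z) :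
    ∃ ν : Measure X, IsProbabilityMeasure ν ∧ π.Invariant ν := by
  -- An ultrafilter gives limits for all test functions at once, without separability.
  set U : Ultrafilter ℕ := Ultrafilter.of atTop
  have hU : (U : Filter ℕ) ≤ atTop := Ultrafilter.of_le atTop
  obtain ⟨Λ, hΛ⟩ := exists_linearMap_tendsto_ultrafilter U (cesaro π z) (abs_cesaro_le π z)
  have hΛle : ∀ (f : X →ᵇ ℝ) (C : ℝ), (∀ i, ∫ y, f y ∂((π ^ i) z) ≤ C) → Λ f ≤ C := fun f C h =>
    le_of_tendsto' (hΛ f) fun n => cesaro_le π z n f h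
  have hΛpos : ∀ f : X →ᵇ ℝ, 0 ≤ f → 0 ≤ Λ f := by
    intro f hf
    have := hΛle (-f) 0 fun i => by
      simpa [integral_neg] using integral_nonneg (μ := (π ^ i) z) hf
    rw [map_neg] at this
    linarith
  have hΛone : Λ 1 = 1 := by
    refine tendsto_nhds_unique (hΛ 1) (tendsto_const_nhds.congr fun n => ?_)
    rw [cesaro_apply]
    simp
    field_simp
  have hΛσ : DaniellMetric.SigmaSmooth Λ := by
    intro φ hφ hlim
    have hnn : ∀ k, 0 ≤ φ k := fun k x =>
      Antitone.le_of_tendsto (f := fun k => φ k x) (fun i j hij => hφ hij x) (hlim x) k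
    rw [Metric.tendsto_atTop]
    intro ε hε
    obtain ⟨k, hk⟩ := exists_forall_integral_le π z μ hpos hequi φ hφ hlim (half_pos hε)
    refine ⟨k, fun j hj => ?_⟩
    rw [Real.dist_eq, sub_zero, abs_of_nonneg (hΛpos _ (hnn j))]
    calc Λ (φ j) ≤ Λ (φ k) := DaniellMetric.mono_of_nonneg Λ hΛpos (hφ hj)
      _ ≤ ε / 2 := hΛle _ _ hk
      _ < ε := half_lt_self hε
  obtain ⟨ν, hν, hνΛ⟩ :=
    DaniellMetric.exists_isProbabilityMeasure_integral_eq Λ hΛpos hΛone hΛσ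
  refine ⟨ν, hν, ?_⟩
  refine ext_of_forall_integral_eq_of_IsFiniteMeasure fun f => ?_
  rw [integral_bind_boundedContinuous, hνΛ f]
  -- The Feller property enters only here, so that `Λ` can be applied to `g`.
  set g : X →ᵇ ℝ := BoundedContinuousFunction.ofNormedAddCommGroup
    (fun x => ∫ y, f y ∂(π x)) (hFeller f) ‖f‖ fun x => abs_integral_le_norm (π x) f
  have hg : ∀ x, g x = ∫ y, f y ∂(π x) := fun x => rfl
  calc ∫ x, ∫ y, f y ∂(π x) ∂ν = Λ g := hνΛ g
    _ = Λ f := by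
      have h1 := tendsto_nhds_unique ((hΛ g).sub (hΛ f)) ((tendsto_cesaro_sub π z f g hg).mono_left hU)
      linarith
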